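/- Let $G$ be a finite-dimensional real Lie group, let $\mathfrak g=\operatorname{Lie}(G)\otimes_{\mathbb R}\mathbb C$, and let $\pi$ be a (strongly continuous) unitary representation of $G$ on a complex Hilbert space $H$. Let $H^\infty\subseteq H$ be the space of smooth vectors, that is, of all $v\in H$ for which the orbit map $g\mapsto \pi(g)v$, $G\to H$, is $C^\infty$. The enveloping algebra $U(\mathfrak g)$ is a complex $*$-algebra for the unique conjugate-linear anti-automorphic involution with $X^*=-X$ for $X\in\operatorname{Lie}(G)$. It acts on $H^\infty$ by the unital algebra homomorphism $\pi^\infty:U(\mathfrak g)\to\operatorname{End}_{\mathbb C}(H^\infty)$ such that, for $X\in \operatorname{Lie}(G)$, $\pi^\infty(X)v$ is the derivative at the identity, in the direction $X$, of the orbit map of $v$. Then $\pi^\infty$ is a dense self-adjoint action, which means the following: $H^\infty$ is dense in $H$; the action is symmetric, i.e. $\langle \pi^\infty(a)x,v\rangle=\langle x,\pi^\infty(a^*)v\rangle$ for $a\in U(\mathfrak g)$ and $x,v\in H^\infty$; and $\pi^\infty$ is equal to its adjoint action. Here the adjoint action has as its domain $(H^\infty)^\dagger$ the set of all $v\in H$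 such that for every $a\in U(\mathfrak g)$ there is a constant $C$ with $|\langle \pi^\infty(a)x,v\rangle|\le C\|x\|$ for all $x\in H^\infty$, and it is determined there by $\langle (\pi^\infty)^\dagger(a)v,x\rangle=\langle v,\pi^\infty(a^*)x\rangle$ for $x\in H^\infty$. Moreover, $$H^\infty=(H^\infty)^\dagger=\bigcap_{n\ge 0}H^n .$$ Here $U^n(\mathfrak g)$ is the subspace of elements of degree $\le n$, $B_n$ is any Hermitian inner product on it, and the Sobolev space $H^n$ is the set of all $v\in H$ for which the linear functional on $U^n(\mathfrak g)\otimes_{\mathbb C} H^\infty$ given by $a\otimes w\mapsto\langle \pi^\infty(a)w,v\rangle$ is bounded with respect to the norm induced by $B_n$ and the inner product of $H$. -/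

import Mathlib

open scoped TensorProduct ComplexConjugate Manifold ContDiff

noncomputable section
/-! ### Partial actions of a star-algebra -/

/-- A partial action of a complex algebra `A` on a Hilbert space `H`: a linear subspace of `H`
together with an action of the unital associative algebra `A` on it. -/
@[ext]
structure PartialAction (A : Type*) [Ring A] [Algebra ℂ A]
    (H : Type*) [NormedAddCommGroup H] [InnerProductSpace ℂ H] where
  domain : Submodule ℂ H
  act : A →ₐ[ℂ] Module.End ℂ domain

namespace PartialAction

variable {A : Type*} [Ring A] [Algebra ℂ A]
  {H : Type*} [NormedAddCommGroup H] [InnerProductSpace ℂ H]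

/-- `ρ.IsExtendedBy ρ'` says that `ρ'` is an extension of `ρ`. -/
def IsExtendedBy (ρ ρ' : PartialAction A H) : Prop :=
  ∃ h : ρ.domain ≤ ρ'.domain, ∀ (a : A) (x : ρ.domain),
    (ρ'.act a (Submodule.inclusion h x) : H) = (ρ.act a x : H)

/-- The partial action is dense if its domain is dense. -/
def IsDense (ρ : PartialAction A H) : Prop :=
  Dense (ρ.domain : Set H)

/-- The domain of the adjoint: all `v` such that, for every `a`, the linear functional
`x ↦ ⟨ρ(a)x, v⟩` on the domain is bounded. (Mathlib's inner product is linear in its second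
variable.) -/
def adjointDomain (ρ : PartialAction A H) : Submodule ℂ H where
  carrier := {v | ∀ a : A, ∃ C : ℝ, ∀ x : ρ.domain, ‖inner ℂ v (ρ.act a x : H)‖ ≤ C * ‖(x : H)‖}
  zero_mem' := fun _ => ⟨0, fun x => by simp⟩
  add_mem' := by
    intro v w hv hw a
    obtain ⟨C, hC⟩ := hv a
    obtain ⟨D, hD⟩ := hw a
    refine ⟨C + D, fun x => ?_⟩
    rw [inner_add_left, add_mul]
    exact (norm_add_le _ _).trans (add_le_add (hC x) (hD x))
  smul_mem' := by
    intro c v hv a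
    obtain ⟨C, hC⟩ := hv a
    refine ⟨‖c‖ * C, fun x => ?_⟩
    rw [inner_smul_left, norm_mul, RCLike.norm_conj, mul_assoc]
    exact mul_le_mul_of_nonneg_left (hC x) (norm_nonneg c)

/-- The functional `a ⊗ w ↦ ⟨ρ(a)w, v⟩` on `U ⊗ W`, where `U` is a subspace of the algebra and
`W` the domain of the action. -/
def pairing (ρ : PartialAction A H) (U : Submodule ℂ A) (v : H) : U ⊗[ℂ] ρ.domain →ₗ[ℂ] ℂ :=
  TensorProduct.lift
    (LinearMap.mk₂ ℂ (fun (a : U) (w : ρ.domain) => inner ℂ v (ρ.act (a : A) w : H))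
      (fun a b w => by simp) (fun c a w => by simp)
      (fun a w x => by simp) (fun c a w => by simp))

theorem pairing_tmul (ρ : PartialAction A H) (U : Submodule ℂ A) (v : H) (a : U) (w : ρ.domain) :
    ρ.pairing U v (a ⊗ₜ w) = inner ℂ v (ρ.act (a : A) w : H) := rfl

theorem pairing_add (ρ : PartialAction A H) (U : Submodule ℂ A) (v w : H) :
    ρ.pairing U (v + w) = ρ.pairing U v + ρ.pairing U w :=
  TensorProduct.ext' fun a x => by simp [pairing_tmul]

theorem pairing_smul (ρ : PartialAction A H) (U : Submodule ℂ A) (c : ℂ) (v : H) :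
    ρ.pairing U (c • v) = conj c • ρ.pairing U v :=
  TensorProduct.ext' fun a x => by simp [pairing_tmul, mul_comm]

/-- The Hilbert norm of `U ⊗ W` given by a Hermitian inner product `B` on `U` and the inner
product of `H` restricted to `W`. -/
def tensorNorm (U : Submodule ℂ A) (B : InnerProductSpace.Core ℂ U) (W : Submodule ℂ H)
    (t : U ⊗[ℂ] W) : ℝ :=
  letI : NormedAddCommGroup U := B.toNormedAddCommGroup
  letI : InnerProductSpace ℂ U := InnerProductSpace.ofCore B.toCore
  ‖t‖

/-- The space of all `v` for which the functional `a ⊗ w ↦ ⟨ρ(a)w, v⟩` is bounded for the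
Hilbert norm of `U ⊗ W`. -/
def boundedPairing (ρ : PartialAction A H) (U : Submodule ℂ A) (B : InnerProductSpace.Core ℂ U) :
    Submodule ℂ H where
  carrier := {v | ∃ C : ℝ, ∀ t, ‖ρ.pairing U v t‖ ≤ C * tensorNorm U B ρ.domain t}
  zero_mem' := ⟨0, fun t => by
    have h : ρ.pairing U 0 = 0 := by simpa using ρ.pairing_smul U 0 0
    simp [h]⟩
  add_mem' := by
    rintro v w ⟨C, hC⟩ ⟨D, hD⟩
    refine ⟨C + D, fun t => ?_⟩
    rw [pairing_add, add_mul]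
    exact (norm_add_le _ _).trans (add_le_add (hC t) (hD t))
  smul_mem' := by
    rintro c v ⟨C, hC⟩
    refine ⟨‖c‖ * C, fun t => ?_⟩
    rw [pairing_smul, LinearMap.smul_apply, norm_smul, RCLike.norm_conj, mul_assoc]
    exact mul_le_mul_of_nonneg_left (hC t) (norm_nonneg c)

theorem eq_of_inner_eq {W : Submodule ℂ H} (hW : Dense (W : Set H)) {w w' : H}
    (h : ∀ x : W, inner ℂ w (x : H) = inner ℂ w' (x : H)) : w = w' :=
  hW.eq_of_inner_left ℂ fun x hx => h ⟨x, hx⟩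

variable [StarRing A] [CompleteSpace H]

theorem exists_adjoint (ρ : PartialAction A H) (h : ρ.IsDense) (a : A) (v : ρ.adjointDomain) :
    ∃ w : ρ.adjointDomain, ∀ x : ρ.domain,
      inner ℂ (w : H) (x : H) = inner ℂ (v : H) (ρ.act (star a) x : H) := by
  obtain ⟨C, hC⟩ := v.2 (star a)
  let f : ρ.domain →ₗ[ℂ] ℂ :=
    (innerSL ℂ (v : H)).toLinearMap ∘ₗ ρ.domain.subtype ∘ₗ (ρ.act (star a))
  let F : ρ.domain →L[ℂ] ℂ := f.mkContinuous C hC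
  have hd : DenseRange ρ.domain.subtypeL := by
    simpa [DenseRange] using show Dense (ρ.domain : Set H) from h
  let F' : H →L[ℂ] ℂ := F.extend ρ.domain.subtypeL
  have key : ∀ x : ρ.domain, inner ℂ ((InnerProductSpace.toDual ℂ H).symm F') (x : H)
      = inner ℂ (v : H) (ρ.act (star a) x : H) := by
    intro x
    rw [InnerProductSpace.toDual_symm_apply]
    exact F.extend_eq hd (ρ.domain.subtypeₗᵢ.isometry.isUniformInducing) x
  refine ⟨⟨(InnerProductSpace.toDual ℂ H).symm F', fun b => ?_⟩, key⟩
  obtain ⟨D, hD⟩ := v.2 (star a * b)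
  refine ⟨D, fun x => ?_⟩
  rw [key]
  simpa using hD x

/-- The operator `ρ†(a)`, characterised by `⟨ρ†(a)v, x⟩ = ⟨v, ρ(a*)x⟩`. -/
def adjointFun (ρ : PartialAction A H) (h : ρ.IsDense) (a : A) (v : ρ.adjointDomain) :
    ρ.adjointDomain :=
  (ρ.exists_adjoint h a v).choose

theorem inner_adjointFun (ρ : PartialAction A H) (h : ρ.IsDense) (a : A) (v : ρ.adjointDomain)
    (x : ρ.domain) :
    inner ℂ (ρ.adjointFun h a v : H) (x : H) = inner ℂ (v : H) (ρ.act (star a) x : H) :=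
  (ρ.exists_adjoint h a v).choose_spec x

theorem adjointFun_eq (ρ : PartialAction A H) (h : ρ.IsDense) {a : A} {v w : ρ.adjointDomain}
    (hw : ∀ x : ρ.domain, inner ℂ (v : H) (ρ.act (star a) x : H) = inner ℂ (w : H) (x : H)) :
    ρ.adjointFun h a v = w :=
  Subtype.ext <| eq_of_inner_eq h fun x => (ρ.inner_adjointFun h a v x).trans (hw x)

variable [StarModule ℂ A]

/-- The adjoint of a dense action. -/
def adjoint (ρ : PartialAction A H) (h : ρ.IsDense) : PartialAction A H where
  domain := ρ.adjointDomain
  act := AlgHom.ofLinearMap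
    { toFun := fun a =>
        { toFun := ρ.adjointFun h a
          map_add' := fun v w => ρ.adjointFun_eq h fun x => by
            simp [inner_adjointFun]
          map_smul' := fun c v => ρ.adjointFun_eq h fun x => by
            simp [inner_adjointFun] }
      map_add' := fun a b => LinearMap.ext fun v => ρ.adjointFun_eq h fun x => by
        simp [inner_adjointFun]
      map_smul' := fun c a => LinearMap.ext fun v => ρ.adjointFun_eq h fun x => by
        simp [inner_adjointFun, mul_comm] }
    (LinearMap.ext fun v => ρ.adjointFun_eq h fun x => by simp)
    (fun a b => LinearMap.ext fun v => ρ.adjointFun_eq h fun x => by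
      simp [inner_adjointFun])

/-- A dense action is symmetric if its adjoint is an extension of it. -/
def IsSymmetric (ρ : PartialAction A H) (h : ρ.IsDense) : Prop :=
  ρ.IsExtendedBy (ρ.adjoint h)

/-- A symmetric dense action is self-adjoint if it is equal to its adjoint. -/
def IsSelfAdjoint (ρ : PartialAction A H) : Prop :=
  ∃ h : ρ.IsDense, ρ.IsSymmetric h ∧ ρ = ρ.adjoint h

end PartialAction

/-! ### The complexified enveloping algebra of a real Lie algebra, as a star-algebra -/

/-- The universal enveloping algebra of the complexification of a real Lie algebra. -/
abbrev ComplexUEA (L : Type*) [LieRing L] [LieAlgebra ℝ L] : Type _ :=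
  UniversalEnvelopingAlgebra ℂ (ℂ ⊗[ℝ] L)

/-- The opposite of a complex algebra, with scalar multiplication twisted by complex
conjugation. -/
def ConjOpposite (A : Type*) : Type _ := Aᵐᵒᵖ

instance (A : Type*) [Ring A] : Ring (ConjOpposite A) := inferInstanceAs (Ring Aᵐᵒᵖ)

instance (A : Type*) [Ring A] [Algebra ℂ A] : Algebra ℂ (ConjOpposite A) :=
  ((algebraMap ℂ Aᵐᵒᵖ).comp (starRingEnd ℂ)).toAlgebra' fun c x =>
    Algebra.commutes (A := Aᵐᵒᵖ) (conj c) x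

namespace ComplexUEA

attribute [local instance 100] LieRing.ofAssociativeRing

variable (L : Type*) [LieRing L] [LieAlgebra ℝ L]

/-- Complex conjugation on the complexification of a real Lie algebra. -/
def conjL : ℂ ⊗[ℝ] L →ₗ⁅ℝ⁆ ℂ ⊗[ℝ] L :=
  LieAlgebra.ExtendScalars.map Complex.conjAe.toAlgHom LieHom.id

theorem conjL_smul (c : ℂ) (t : ℂ ⊗[ℝ] L) : conjL L (c • t) = conj c • conjL L t := by
  induction t with
  | zero => simp
  | tmul z x => simp [conjL, TensorProduct.smul_tmul']
  | add s t hs ht => rw [smul_add, map_add, hs, ht, map_add, smul_add]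

theorem conjL_conjL (t : ℂ ⊗[ℝ] L) : conjL L (conjL L t) = t := by
  induction t with
  | zero => simp
  | tmul z x => simp [conjL]
  | add s t hs ht => rw [map_add, map_add, hs, ht]

theorem conjOpposite_smul {A : Type*} [Ring A] [Algebra ℂ A] (c : ℂ) (a : A) :
    c • (show ConjOpposite A from MulOpposite.op a) = MulOpposite.op (conj c • a) := by
  rw [Algebra.smul_def]
  change algebraMap ℂ Aᵐᵒᵖ (conj c) * MulOpposite.op a = _
  rw [← Algebra.smul_def]
  rfl

/-- Minus conjugation, as a Lie algebra morphism to the twisted opposite algebra. -/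
def starLie : ℂ ⊗[ℝ] L →ₗ⁅ℂ⁆ ConjOpposite (ComplexUEA L) where
  toFun t := MulOpposite.op (-UniversalEnvelopingAlgebra.ι ℂ (conjL L t))
  map_add' s t := by
    rw [map_add, map_add, neg_add, MulOpposite.op_add]; rfl
  map_smul' c t := by
    rw [conjL_smul, map_smul, ← smul_neg]
    exact (conjOpposite_smul c _).symm
  map_lie' {s t} := by
    apply MulOpposite.unop_injective
    change -UniversalEnvelopingAlgebra.ι ℂ (conjL L ⁅s, t⁆)
      = -UniversalEnvelopingAlgebra.ι ℂ (conjL L t) * -UniversalEnvelopingAlgebra.ι ℂ (conjL L s)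
        - -UniversalEnvelopingAlgebra.ι ℂ (conjL L s) * -UniversalEnvelopingAlgebra.ι ℂ (conjL L t)
    rw [LieHom.map_lie, LieHom.map_lie, LieRing.of_associative_ring_bracket]
    simp

/-- The involution of the enveloping algebra, as a morphism to the twisted opposite algebra. -/
def starHom : ComplexUEA L →ₐ[ℂ] ConjOpposite (ComplexUEA L) :=
  UniversalEnvelopingAlgebra.lift ℂ (starLie L)

/-- The conjugate-linear anti-automorphism of the enveloping algebra which is minus the identity on
the real Lie algebra. -/
instance : Star (ComplexUEA L) where
  star a := MulOpposite.unop (starHom L a)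

theorem star_def (a : ComplexUEA L) : star a = MulOpposite.unop (starHom L a) := rfl

theorem star_ι (t : ℂ ⊗[ℝ] L) :
    star (UniversalEnvelopingAlgebra.ι ℂ t : ComplexUEA L)
      = -UniversalEnvelopingAlgebra.ι ℂ (conjL L t) := by
  rw [star_def, starHom, UniversalEnvelopingAlgebra.lift_ι_apply]
  rfl

theorem star_ι_real (x : L) :
    star (UniversalEnvelopingAlgebra.ι ℂ ((1 : ℂ) ⊗ₜ[ℝ] x) : ComplexUEA L)
      = -UniversalEnvelopingAlgebra.ι ℂ ((1 : ℂ) ⊗ₜ[ℝ] x) := by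
  rw [star_ι]
  simp [conjL]

theorem star_add' (a b : ComplexUEA L) : star (a + b) = star a + star b := by
  rw [star_def, map_add]; rfl

theorem star_mul' (a b : ComplexUEA L) : star (a * b) = star b * star a := by
  rw [star_def, map_mul]; rfl

theorem star_algebraMap' (c : ℂ) :
    star (algebraMap ℂ (ComplexUEA L) c) = algebraMap ℂ (ComplexUEA L) (conj c) := by
  rw [star_def, AlgHom.commutes]; rfl

theorem star_smul' (c : ℂ) (a : ComplexUEA L) : star (c • a) = conj c • star a := by
  rw [Algebra.smul_def, star_mul', star_algebraMap', ← Algebra.commutes, ← Algebra.smul_def]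

/-- Applying the involution twice. -/
def starStar : ComplexUEA L →ₐ[ℂ] ComplexUEA L where
  toFun a := star (star a)
  map_one' := by
    have := star_algebraMap' L 1
    simp only [map_one] at this
    rw [this, this]
  map_mul' a b := by rw [star_mul', star_mul']
  map_zero' := by
    have := star_algebraMap' L 0
    simp only [map_zero] at this
    rw [this, this]
  map_add' a b := by rw [star_add', star_add']
  commutes' c := by rw [star_algebraMap', star_algebraMap', Complex.conj_conj]

theorem starStar_eq : starStar L = AlgHom.id ℂ _ := by
  apply UniversalEnvelopingAlgebra.hom_ext
  refine LieHom.ext fun t => ?_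
  change star (star (UniversalEnvelopingAlgebra.ι ℂ t : ComplexUEA L))
    = UniversalEnvelopingAlgebra.ι ℂ t
  rw [star_ι, ← map_neg, star_ι, map_neg (conjL L), conjL_conjL, map_neg, neg_neg]

instance : StarRing (ComplexUEA L) where
  star_involutive a := congrArg (fun f => f a) (starStar_eq L)
  star_mul := star_mul' L
  star_add := star_add' L

instance : StarModule ℂ (ComplexUEA L) where
  star_smul := star_smul' L

/-- The degree filtration: the span of the products of at most `n` elements of the Lie algebra. -/
def filtration (n : ℕ) : Submodule ℂ (ComplexUEA L) :=
  (1 ⊔ LinearMap.range (UniversalEnvelopingAlgebra.ι ℂ : ℂ ⊗[ℝ] L →ₗ⁅ℂ⁆ ComplexUEA L).toLinearMap) ^ n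

end ComplexUEA
end

/-! ### Lie groups and their unitary representations -/

noncomputable section

open VectorField

section Manifold

instance (priority := 50) completeSpace_of_finiteDimensional_real (E : Type*)
    [NormedAddCommGroup E] [NormedSpace ℝ E] [FiniteDimensional ℝ E] : CompleteSpace E :=
  FiniteDimensional.complete ℝ E

variable {E : Type*} [NormedAddCommGroup E] [NormedSpace ℝ E]
  {M₀ : Type*} [TopologicalSpace M₀] {I : ModelWithCorners ℝ E M₀}
  {M : Type*} [TopologicalSpace M] [ChartedSpace M₀ M]
  {F : Type*} [NormedAddCommGroup F] [NormedSpace ℝ F]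

/-- The derivative of a vector-valued function along a vector field. -/
def dirDeriv (I : ModelWithCorners ℝ E M₀) (V : Π x : M, TangentSpace I x) (f : M → F) (x : M) :
    F :=
  mfderiv I 𝓘(ℝ, F) f x (V x)

theorem contMDiff_dirDeriv [IsManifold I ∞ M] {V : Π x : M, TangentSpace I x} {f : M → F}
    (hV : ContMDiff I I.tangent ∞ (fun x => (⟨x, V x⟩ : TangentBundle I M)))
    (hf : ContMDiff I 𝓘(ℝ, F) ∞ f) : ContMDiff I 𝓘(ℝ, F) ∞ (dirDeriv I V f) := by
  have h1 : ContMDiff I.tangent 𝓘(ℝ, F).tangent ∞ (tangentMap I 𝓘(ℝ, F) f) :=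
    hf.contMDiff_tangentMap (by simp)
  have h2 := (contMDiff_snd_tangentBundle_modelSpace F 𝓘(ℝ, F) (n := ∞)).comp (h1.comp hV)
  exact h2

theorem dirDeriv_extChartAt_symm [IsManifold I ∞ M] [CompleteSpace E]
    (V : Π x : M, TangentSpace I x) {f : M → F}
    (hf : ContMDiff I 𝓘(ℝ, F) ∞ f) (x : M) {y : E} (hy : y ∈ (extChartAt I x).target) :
    fderivWithin ℝ (f ∘ (extChartAt I x).symm) (Set.range I) y
        (mpullbackWithin 𝓘(ℝ, E) I (extChartAt I x).symm V (Set.range I) y)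
      = dirDeriv I V f ((extChartAt I x).symm y) := by
  have hinv := isInvertible_mfderivWithin_extChartAt_symm (I := I) hy
  have hyr : y ∈ Set.range I := extChartAt_target_subset_range x hy
  have hu : UniqueMDiffWithinAt 𝓘(ℝ, E) (Set.range I) y := I.uniqueMDiffOn y hyr
  have hd : MDifferentiableWithinAt 𝓘(ℝ, E) I (extChartAt I x).symm (Set.range I) y :=
    mdifferentiableWithinAt_extChartAt_symm hy
  have hfd : MDifferentiableAt I 𝓘(ℝ, F) f ((extChartAt I x).symm y) :=
    hf.mdifferentiable (by simp) _
  rw [← mfderivWithin_eq_fderivWithin]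
  rw [mfderiv_comp_mfderivWithin y hfd hd hu]
  exact congrArg (mfderiv I 𝓘(ℝ, F) f ((extChartAt I x).symm y))
    (hinv.self_apply_inverse (V ((extChartAt I x).symm y)))

theorem dirDeriv_mlieBracket [CompleteSpace E] [IsManifold I ∞ M]
    {V W : Π x : M, TangentSpace I x} {f : M → F}
    (hV : ContMDiff I I.tangent ∞ (fun x => (⟨x, V x⟩ : TangentBundle I M)))
    (hW : ContMDiff I I.tangent ∞ (fun x => (⟨x, W x⟩ : TangentBundle I M)))
    (hf : ContMDiff I 𝓘(ℝ, F) ∞ f) (x : M) :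
    dirDeriv I (mlieBracket I V W) f x
      = dirDeriv I V (dirDeriv I W f) x - dirDeriv I W (dirDeriv I V f) x := by
  have hx : extChartAt I x x ∈ (extChartAt I x).target := mem_extChartAt_target x
  have hxr : extChartAt I x x ∈ Set.range I := extChartAt_target_subset_range x hx
  have hcd : ContDiffWithinAt ℝ ∞ (f ∘ (extChartAt I x).symm) (Set.range I) (extChartAt I x x) := by
    exact (contMDiffAt_iff.1 (hf x)).2
  have hVd := MDifferentiableWithinAt.differentiableWithinAt_mpullbackWithin_vectorField
    (s := Set.univ) (V := V) (x := x) ((hV.mdifferentiable (by simp)) x).mdifferentiableWithinAt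
  have hWd := MDifferentiableWithinAt.differentiableWithinAt_mpullbackWithin_vectorField
    (s := Set.univ) (V := W) (x := x) ((hW.mdifferentiable (by simp)) x).mdifferentiableWithinAt
  simp only [Set.preimage_univ, Set.univ_inter] at hVd hWd
  have hmain := fderivWithin_apply_lieBracket hcd
    (by simpa using (ENat.LEInfty.out : (2 : ℕ∞ω) ≤ ∞)) I.uniqueDiffOn
    (I.range_subset_closure_interior hxr) hxr hWd hVd
  have hfun (U U' : Π x : M, TangentSpace I x)
      (hU : ContMDiff I I.tangent ∞ (fun x => (⟨x, U x⟩ : TangentBundle I M))) :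
      fderivWithin ℝ (fun y => fderivWithin ℝ (f ∘ (extChartAt I x).symm) (Set.range I) y
        (mpullbackWithin 𝓘(ℝ, E) I (extChartAt I x).symm U (Set.range I) y)) (Set.range I)
        (extChartAt I x x)
        (mpullbackWithin 𝓘(ℝ, E) I (extChartAt I x).symm U' (Set.range I) (extChartAt I x x))
      = dirDeriv I U' (dirDeriv I U f) x := by
    have h1 := dirDeriv_extChartAt_symm U' (contMDiff_dirDeriv hU hf) x hx
    rw [extChartAt_to_inv] at h1
    rw [← h1]
    congr 1
    apply Filter.EventuallyEq.fderivWithin_eq_of_mem _ hxr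
    filter_upwards [extChartAt_target_mem_nhdsWithin x] with y hy
    exact dirDeriv_extChartAt_symm U hf x hy
  rw [hfun W V hW, hfun V W hV] at hmain
  rw [← hmain]
  have hb : mlieBracket I V W x = lieBracketWithin ℝ
      (mpullbackWithin 𝓘(ℝ, E) I (extChartAt I x).symm V (Set.range I))
      (mpullbackWithin 𝓘(ℝ, E) I (extChartAt I x).symm W (Set.range I))
      (Set.range I) (extChartAt I x x) := by
    rw [← mlieBracketWithin_univ, mlieBracketWithin_apply, mfderiv_extChartAt_self]
    simp only [Set.preimage_univ, Set.univ_inter]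
    erw [ContinuousLinearMap.inverse_id]
    rfl
  have hm : mfderiv I 𝓘(ℝ, F) f x
      = fderivWithin ℝ (f ∘ (extChartAt I x).symm) (Set.range I) (extChartAt I x x) := by
    exact if_pos (hf.mdifferentiable (by simp) x)
  rw [dirDeriv, hb, hm]
  rfl

end Manifold

section LieGroup

variable {E : Type*} [NormedAddCommGroup E] [NormedSpace ℝ E]
  {M₀ : Type*} [TopologicalSpace M₀] {I : ModelWithCorners ℝ E M₀}
  {G : Type*} [TopologicalSpace G] [ChartedSpace M₀ G] [Group G]

instance [LieGroup I ∞ G] : LieGroup I (minSmoothness ℝ 3) G :=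
  LieGroup.of_le (n := ∞) (by simpa using (ENat.LEInfty.out : (3 : ℕ∞ω) ≤ ∞))

theorem contMDiff_mulInvariantVectorField_infty [LieGroup I ∞ G] (v : GroupLieAlgebra I G) :
    ContMDiff I I.tangent ∞
      (fun g : G => (⟨g, mulInvariantVectorField v g⟩ : TangentBundle I G)) := by
  let fg : G → TangentBundle I G := fun g ↦ ⟨g, 0⟩
  have sfg : ContMDiff I I.tangent ∞ fg := Bundle.contMDiff_zeroSection _ _
  let fv : G → TangentBundle I G := fun _ ↦ ⟨1, v⟩
  have sfv : ContMDiff I I.tangent ∞ fv := contMDiff_const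
  let F₁ : G → (TangentBundle I G × TangentBundle I G) := fun g ↦ (fg g, fv g)
  have S₁ : ContMDiff I (I.tangent.prod I.tangent) ∞ F₁ := sfg.prodMk sfv
  let F₂ : (TangentBundle I G × TangentBundle I G) → TangentBundle (I.prod I) (G × G) :=
    (equivTangentBundleProd I G I G).symm
  have S₂ : ContMDiff (I.tangent.prod I.tangent) (I.prod I).tangent ∞ F₂ :=
    contMDiff_equivTangentBundleProd_symm
  let F₃ : TangentBundle (I.prod I) (G × G) → TangentBundle I G :=
    tangentMap (I.prod I) I (fun (p : G × G) ↦ p.1 * p.2)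
  have S₃ : ContMDiff (I.prod I).tangent I.tangent ∞ F₃ :=
    (contMDiff_mul I ∞).contMDiff_tangentMap (by simp)
  convert! (S₃.comp S₂).comp S₁ with g
  · simp [F₁, F₂, F₃, fg, fv]
  · simp only [Function.comp_apply, tangentMap, F₃, F₂, F₁, fg, fv]
    rw [mfderiv_prod_eq_add_apply ((contMDiff_mul I ∞).mdifferentiableAt (by simp))]
    simp only [mulInvariantVectorField]
    erw [map_zero, zero_add]
    rfl

variable {H : Type*} [NormedAddCommGroup H] [InnerProductSpace ℂ H] [CompleteSpace H]

namespace UnitaryRep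

/-- The space of smooth vectors: those whose orbit map is smooth. -/
def smoothVectors (I : ModelWithCorners ℝ E M₀) (π : G →* unitary (H →L[ℂ] H)) :
    Submodule ℂ H where
  carrier := {v | ContMDiff I 𝓘(ℝ, H) ∞ fun g => (π g : H →L[ℂ] H) v}
  zero_mem' := by
    simpa using (contMDiff_const : ContMDiff I 𝓘(ℝ, H) ∞ fun _ : G => (0 : H))
  add_mem' := by
    intro v w hv hw
    have := ContMDiff.add hv hw
    simpa [Pi.add_def] using this
  smul_mem' := by
    intro c v hv
    have h : ContMDiff 𝓘(ℝ, H) 𝓘(ℝ, H) ∞ (fun w : H => c • w) :=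
      (contDiff_const_smul c).contMDiff
    have := h.comp (show ContMDiff I 𝓘(ℝ, H) ∞ fun g => (π g : H →L[ℂ] H) v from hv)
    simpa [Function.comp_def] using this

variable (π : G →* unitary (H →L[ℂ] H))

/-- The vector `dπ(X)v`, the derivative at the identity, in the direction `X`, of the orbit map of
`v`. -/
def lieDeriv (X : GroupLieAlgebra I G) (v : H) : H :=
  mfderiv I 𝓘(ℝ, H) (fun g => (π g : H →L[ℂ] H) v) 1 X

theorem mdifferentiableAt_orbit (v : smoothVectors I π) (g : G) :
    MDifferentiableAt I 𝓘(ℝ, H) (fun g => (π g : H →L[ℂ] H) v) g :=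
  ContMDiff.mdifferentiable (show ContMDiff I 𝓘(ℝ, H) ∞ _ from v.2) (by simp) g

theorem mfderiv_clm_comp (T : H →L[ℂ] H) (v : smoothVectors I π) (g : G) (X : TangentSpace I g) :
    mfderiv I 𝓘(ℝ, H) (fun g => T ((π g : H →L[ℂ] H) v)) g X
      = T (mfderiv I 𝓘(ℝ, H) (fun g => (π g : H →L[ℂ] H) v) g X) := by
  have hT : HasMFDerivAt 𝓘(ℝ, H) 𝓘(ℝ, H) (fun w => T w) ((π g : H →L[ℂ] H) v)
      (T.restrictScalars ℝ) := (T.restrictScalars ℝ).hasFDerivAt.hasMFDerivAt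
  have := (hT.comp g (mdifferentiableAt_orbit π v g).hasMFDerivAt).mfderiv
  exact congrArg (fun L => L X) this

theorem dirDeriv_orbit [LieGroup I ∞ G] (X : GroupLieAlgebra I G) (v : smoothVectors I π) (g : G) :
    dirDeriv I (mulInvariantVectorField X) (fun g => (π g : H →L[ℂ] H) v) g
      = (π g : H →L[ℂ] H) (lieDeriv π X (v : H)) := by
  have h1 : MDifferentiableAt I I (fun h : G => g * h) 1 :=
    (contMDiff_mul_left (I := I) (n := ∞) (a := g)).mdifferentiable (by simp) 1
  have h2 := mdifferentiableAt_orbit π v (g * 1)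
  have h3 := congrArg (fun L => L X) (mfderiv_comp (1 : G) h2 h1)
  rw [lieDeriv, ← mfderiv_clm_comp]
  have h4 : (fun h => (π g : H →L[ℂ] H) ((π h : H →L[ℂ] H) v))
      = (fun g => (π g : H →L[ℂ] H) (v : H)) ∘ fun h : G => g * h := by
    funext h
    simp
  rw [h4]
  refine Eq.trans ?_ h3.symm
  change mfderiv I 𝓘(ℝ, H) (fun g => (π g : H →L[ℂ] H) (v : H)) g
      (mfderiv I I (fun h : G => g * h) 1 X)
    = mfderiv I 𝓘(ℝ, H) (fun g => (π g : H →L[ℂ] H) (v : H)) (g * 1)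
      (mfderiv I I (fun h : G => g * h) 1 X)
  rw [mul_one]

theorem lieDeriv_mem [LieGroup I ∞ G] (X : GroupLieAlgebra I G) (v : smoothVectors I π) :
    lieDeriv π X (v : H) ∈ smoothVectors I π := by
  change ContMDiff I 𝓘(ℝ, H) ∞ fun g => (π g : H →L[ℂ] H) (lieDeriv π X (v : H))
  simp only [← dirDeriv_orbit]
  exact contMDiff_dirDeriv (contMDiff_mulInvariantVectorField_infty X) v.2

theorem lieDeriv_add (X : GroupLieAlgebra I G) (v w : smoothVectors I π) :
    lieDeriv π X ((v + w : smoothVectors I π) : H) = lieDeriv π X (v : H) + lieDeriv π X (w : H) := by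
  have := (mdifferentiableAt_orbit π v 1).hasMFDerivAt.add
    (mdifferentiableAt_orbit π w 1).hasMFDerivAt
  have h2 : (fun g => (π g : H →L[ℂ] H) ((v + w : smoothVectors I π) : H))
      = (fun g => (π g : H →L[ℂ] H) (v : H)) + fun g => (π g : H →L[ℂ] H) (w : H) := by
    funext g
    simp
  rw [lieDeriv, h2, this.mfderiv]
  rfl

theorem lieDeriv_smul (X : GroupLieAlgebra I G) (c : ℂ) (v : smoothVectors I π) :
    lieDeriv π X ((c • v : smoothVectors I π) : H) = c • lieDeriv π X (v : H) := by
  have := mfderiv_clm_comp π (c • ContinuousLinearMap.id ℂ H) v 1 X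
  have h2 : (fun g => (π g : H →L[ℂ] H) ((c • v : smoothVectors I π) : H))
      = fun g => (c • ContinuousLinearMap.id ℂ H) ((π g : H →L[ℂ] H) (v : H)) := by
    funext g
    simp
  rw [lieDeriv, h2]
  exact this

/-- The action of a Lie algebra element on the smooth vectors. -/
def derivEnd [LieGroup I ∞ G] (X : GroupLieAlgebra I G) : Module.End ℂ (smoothVectors I π) where
  toFun v := ⟨lieDeriv π X v, lieDeriv_mem π X v⟩
  map_add' v w := Subtype.ext (lieDeriv_add π X v w)
  map_smul' c v := Subtype.ext (lieDeriv_smul π X c v)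

theorem lieDeriv_lie [FiniteDimensional ℝ E] [LieGroup I ∞ G] (X Y : GroupLieAlgebra I G)
    (v : smoothVectors I π) :
    lieDeriv π ⁅X, Y⁆ (v : H) = lieDeriv π X (lieDeriv π Y (v : H)) - lieDeriv π Y (lieDeriv π X (v : H)) := by
  have h := dirDeriv_mlieBracket (contMDiff_mulInvariantVectorField_infty X)
    (contMDiff_mulInvariantVectorField_infty Y)
    (show ContMDiff I 𝓘(ℝ, H) ∞ fun g => (π g : H →L[ℂ] H) v from v.2) 1
  have hf (Z : GroupLieAlgebra I G) (v : smoothVectors I π) :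
      dirDeriv I (mulInvariantVectorField Z) (fun g => (π g : H →L[ℂ] H) v)
        = fun g => (π g : H →L[ℂ] H) (lieDeriv π Z (v : H)) :=
    funext (dirDeriv_orbit π Z v)
  have e1 := dirDeriv_orbit π X ⟨_, lieDeriv_mem π Y v⟩ 1
  have e2 := dirDeriv_orbit π Y ⟨_, lieDeriv_mem π X v⟩ 1
  rw [hf, hf] at h
  rw [e1, e2, map_one] at h
  exact h

attribute [local instance 100] LieRing.ofAssociativeRing

/-- The action of the real Lie algebra on the smooth vectors. -/
def derivLie [FiniteDimensional ℝ E] [LieGroup I ∞ G] :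
    GroupLieAlgebra I G →ₗ⁅ℝ⁆ Module.End ℂ (smoothVectors I π) where
  toFun X := derivEnd π X
  map_add' X Y := LinearMap.ext fun v => Subtype.ext
    ((mfderiv I 𝓘(ℝ, H) (fun g => (π g : H →L[ℂ] H) (v : H)) 1).map_add X Y)
  map_smul' c X := LinearMap.ext fun v => Subtype.ext
    ((mfderiv I 𝓘(ℝ, H) (fun g => (π g : H →L[ℂ] H) (v : H)) 1).map_smul c X)
  map_lie' {X Y} := LinearMap.ext fun v => Subtype.ext (lieDeriv_lie π X Y v)

/-- Its complex-linear extension to the complexified Lie algebra. -/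
def derivLieC [FiniteDimensional ℝ E] [LieGroup I ∞ G] :
    ℂ ⊗[ℝ] GroupLieAlgebra I G →ₗ⁅ℂ⁆ Module.End ℂ (smoothVectors I π) where
  toLinearMap := (derivLie (I := I) π : _ →ₗ[ℝ] _).liftBaseChange ℂ
  map_lie' {s t} := by
    induction s with
    | zero => simp
    | add s s' hs hs' =>
      simp only [add_lie, map_add, AddHom.toFun_eq_coe, LinearMap.coe_toAddHom] at hs hs' ⊢
      rw [hs, hs']
    | tmul z X =>
      induction t with
      | zero => simp
      | add t t' hs hs' =>
        simp only [lie_add, map_add, AddHom.toFun_eq_coe, LinearMap.coe_toAddHom] at hs hs' ⊢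
        rw [hs, hs']
      | tmul w Y =>
        simp [smul_lie, lie_smul, smul_smul, mul_comm]

/-- The natural action of the enveloping algebra of the complexified Lie algebra on the smooth
vectors. -/
def smoothAction (I : ModelWithCorners ℝ E M₀) [FiniteDimensional ℝ E] [LieGroup I ∞ G]
    (π : G →* unitary (H →L[ℂ] H)) : PartialAction (ComplexUEA (GroupLieAlgebra I G)) H where
  domain := smoothVectors I π
  act := UniversalEnvelopingAlgebra.lift ℂ (derivLieC π)

theorem smoothAction_ι [FiniteDimensional ℝ E] [LieGroup I ∞ G] (X : GroupLieAlgebra I G)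
    (v : smoothVectors I π) :
    (((smoothAction I π).act (UniversalEnvelopingAlgebra.ι ℂ (1 ⊗ₜ[ℝ] X)) v : smoothVectors I π) : H)
      = mfderiv I 𝓘(ℝ, H) (fun g => (π g : H →L[ℂ] H) v) 1 X := by
  have h : (smoothAction I π).act (UniversalEnvelopingAlgebra.ι ℂ (1 ⊗ₜ[ℝ] X)) = derivEnd π X := by
    refine (UniversalEnvelopingAlgebra.lift_ι_apply ℂ (derivLieC (I := I) π) _).trans ?_
    change (1 : ℂ) • derivEnd π X = _
    exact one_smul _ _
  rw [h]
  rfl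

/-- The `n`-th Sobolev space of the representation, for a Hermitian inner product `B` on
`Uⁿ(𝔤)`. -/
def sobolevSpace (I : ModelWithCorners ℝ E M₀) [FiniteDimensional ℝ E] [LieGroup I ∞ G]
    (π : G →* unitary (H →L[ℂ] H)) (n : ℕ)
    (B : InnerProductSpace.Core ℂ (ComplexUEA.filtration (GroupLieAlgebra I G) n)) :
    Submodule ℂ H :=
  (smoothAction I π).boundedPairing (ComplexUEA.filtration (GroupLieAlgebra I G) n) B

end UnitaryRep
end LieGroup
end

/-!
Write `W` for the smooth vectors, `D` for the domain of the adjoint action, and `dπ(X)` for the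
action of `X ∈ Lie(G)` on `W`.

Density of `W` is Gårding's argument (`UnitaryRep.dense_smoothVectors`): the averages
`∫ f(h) π(h)v dh` over Haar measure, with `f` a bump function near the identity, approximate `v`.
Translating such an average by `g` replaces `f` by `f(g⁻¹ ·)`, so smoothness in `g` is smoothness of
a parameter integral, which in a chart is a convolution with a smooth kernel.

The action is symmetric (`UnitaryRep.inner_smoothAction`) since differentiating
`⟨π(g)v, π(g)w⟩ = ⟨v, w⟩` shows that `dπ(X)` is skew-symmetric, and `Lie(G)` generates the enveloping
algebra. Hence `W ≤ D`, and the adjoint action extends the given one.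

The main point is `D ≤ W` (`UnitaryRep.adjointDomain_le_smoothVectors`). Let `v ∈ D` and `x ∈ W`.
Then `⟨π(g)v, x⟩ = ⟨v, π(g⁻¹)x⟩` is differentiable in `g`, and its derivative along the left-invariant
field of `X` is `-⟨v, dπ(X)π(g⁻¹)x⟩ = ⟨π(g)ρ†(X)v, x⟩`, where `ρ†` is the adjoint action. So the orbit
map of `v` has a weak derivative, tested against the dense subspace `W`, and this weak derivative is
continuous because it consists of orbit maps of the vectors `ρ†(X)v`. A mean value argument
(`hasFDerivAt_of_inner_of_dense`) makes it a derivative in norm. As `ρ†(X)v` lies in `D` again,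
induction on `n` shows that all these orbit maps are `C^n`. No elliptic regularity is needed, because
membership in `D` controls every element of the enveloping algebra.

Finally, each step of the degree filtration is finite-dimensional and their union is the whole
algebra, so boundedness for the Hilbert norms of all the spaces `Uⁿ(𝔤) ⊗ W` is the same as
boundedness of `x ↦ ⟨v, ρ(a)x⟩` for each `a` separately (`PartialAction.iInf_boundedPairing_eq`).
-/

/-! ### Generators and filtration of the enveloping algebra -/

section EnvelopingAlgebra

attribute [local instance 100] LieRing.ofAssociativeRing

/-- An enveloping algebra is generated, as a unital algebra, by the Lie algebra. -/
theorem UniversalEnvelopingAlgebra.generators_induction {R L : Type*} [CommRing R] [LieRing L]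
    [LieAlgebra R L] {p : UniversalEnvelopingAlgebra R L → Prop}
    (algebraMap : ∀ r, p (algebraMap R _ r)) (ι : ∀ x, p (UniversalEnvelopingAlgebra.ι R x))
    (mul : ∀ a b, p a → p b → p (a * b)) (add : ∀ a b, p a → p b → p (a + b))
    (a : UniversalEnvelopingAlgebra R L) : p a := by
  obtain ⟨t, rfl⟩ : ∃ t, UniversalEnvelopingAlgebra.mkAlgHom R L t = a := RingCon.mk'_surjective _ a
  induction t using TensorAlgebra.induction with
  | algebraMap r => rw [AlgHom.commutes]; exact algebraMap r
  | ι x => exact ι x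
  | mul a b ha hb => rw [map_mul]; exact mul _ _ ha hb
  | add a b ha hb => rw [map_add]; exact add _ _ ha hb

namespace ComplexUEA

variable (L : Type*) [LieRing L] [LieAlgebra ℝ L]

theorem filtration_mono : Monotone (filtration L) := fun _ _ h =>
  pow_le_pow_right' le_sup_left h

theorem exists_mem_filtration (a : ComplexUEA L) : ∃ n, a ∈ filtration L n := by
  induction a using UniversalEnvelopingAlgebra.generators_induction with
  | algebraMap r =>
    exact ⟨0, by simp [filtration]⟩
  | ι x =>
    refine ⟨1, ?_⟩
    rw [filtration, pow_one]
    exact Submodule.mem_sup_right ⟨x, rfl⟩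
  | mul a b ha hb =>
    obtain ⟨m, hm⟩ := ha
    obtain ⟨n, hn⟩ := hb
    refine ⟨m + n, ?_⟩
    rw [filtration, pow_add]
    exact Submodule.mul_mem_mul hm hn
  | add a b ha hb =>
    obtain ⟨m, hm⟩ := ha
    obtain ⟨n, hn⟩ := hb
    exact ⟨max m n, add_mem (filtration_mono L (le_max_left m n) hm)
      (filtration_mono L (le_max_right m n) hn)⟩

instance finiteDimensional_filtration [FiniteDimensional ℝ L] (n : ℕ) :
    FiniteDimensional ℂ (filtration L n) := by
  refine Module.Finite.of_fg (Submodule.FG.pow (Submodule.FG.sup ?_ ?_) n)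
  · rw [Submodule.one_eq_span]
    exact Submodule.fg_span_singleton 1
  · rw [LinearMap.range_eq_map]
    exact (Module.Finite.fg_top (R := ℂ) (M := ℂ ⊗[ℝ] L)).map _

end ComplexUEA

end EnvelopingAlgebra

/-! ### Partial actions, their adjoints, and bounded pairings -/

namespace PartialAction

variable {A : Type*} [Ring A] [Algebra ℂ A]
  {H : Type*} [NormedAddCommGroup H] [InnerProductSpace ℂ H]

theorem IsExtendedBy.eq_of_domain_le {ρ ρ' : PartialAction A H} (h : ρ.IsExtendedBy ρ')
    (hle : ρ'.domain ≤ ρ.domain) : ρ = ρ' := by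
  obtain ⟨D, f⟩ := ρ
  obtain ⟨D', f'⟩ := ρ'
  obtain ⟨h1, h2⟩ := h
  obtain rfl : D = D' := le_antisymm h1 hle
  congr 1
  ext a x
  exact (h2 a x).symm

/-- If the functional is bounded on the simple tensors `a ⊗ w`, separately for each `a` in the
finite-dimensional space `U`, then it is bounded for the Hilbert norm: expand in an orthonormal
basis of `U`. -/
theorem adjointDomain_le_boundedPairing (ρ : PartialAction A H) (U : Submodule ℂ A)
    [FiniteDimensional ℂ U] (B : InnerProductSpace.Core ℂ U) :
    ρ.adjointDomain ≤ ρ.boundedPairing U B := by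
  intro v hv
  let _ : NormedAddCommGroup U := B.toNormedAddCommGroup
  let _ : InnerProductSpace ℂ U := InnerProductSpace.ofCore B.toCore
  let e := stdOrthonormalBasis ℂ U
  choose C hC using fun i => hv (e i : A)
  refine ⟨∑ i, |C i|, fun t => ?_⟩
  change _ ≤ _ * ‖t‖
  -- the component of `t` along `e i`
  let c (i) : U ⊗[ℂ] ρ.domain →ₗ[ℂ] ρ.domain :=
    (TensorProduct.lid ℂ ρ.domain).toLinearMap ∘ₗ
      ((innerSL ℂ (e i)).rTensor ρ.domain).toLinearMap
  have hc (i) : ‖c i t‖ ≤ ‖t‖ := by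
    have h1 := ((innerSL ℂ (e i)).rTensor ρ.domain).le_opNorm t
    have h2 : ‖(innerSL ℂ (e i)).rTensor ρ.domain‖ ≤ 1 :=
      (ContinuousLinearMap.norm_rTensor_le _ _).trans (by simp [e.orthonormal.1 i])
    calc ‖c i t‖ = ‖(innerSL ℂ (e i)).rTensor ρ.domain t‖ := TensorProduct.norm_lid _
      _ ≤ _ := h1
      _ ≤ 1 * ‖t‖ := by gcongr
      _ = ‖t‖ := one_mul _
  have hsum : ρ.pairing U v t = ∑ i, inner ℂ v (ρ.act (e i : A) (c i t) : H) := by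
    clear hc
    induction t with
    | zero => simp
    | add s t hs ht =>
      rw [map_add, hs, ht, ← Finset.sum_add_distrib]
      simp
    | tmul a w =>
      rw [pairing_tmul]
      conv_lhs => rw [← e.sum_repr' a]
      simp [c]
  rw [hsum, Finset.sum_mul]
  refine (norm_sum_le _ _).trans (Finset.sum_le_sum fun i _ => (hC i _).trans ?_)
  exact mul_le_mul (le_abs_self _) (hc i) (norm_nonneg _) (abs_nonneg _)

theorem iInf_boundedPairing_eq (ρ : PartialAction A H) (U : ℕ → Submodule ℂ A)
    [∀ n, FiniteDimensional ℂ (U n)] (hU : ∀ a, ∃ n, a ∈ U n)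
    (B : ∀ n, InnerProductSpace.Core ℂ (U n)) :
    ⨅ n, ρ.boundedPairing (U n) (B n) = ρ.adjointDomain := by
  refine le_antisymm (fun v hv a => ?_)
    (le_iInf fun n => ρ.adjointDomain_le_boundedPairing (U n) (B n))
  obtain ⟨n, ha⟩ := hU a
  obtain ⟨C, hC⟩ := Submodule.mem_iInf _ |>.1 hv n
  let _ : NormedAddCommGroup (U n) := (B n).toNormedAddCommGroup
  let _ : InnerProductSpace ℂ (U n) := InnerProductSpace.ofCore (B n).toCore
  refine ⟨C * ‖(⟨a, ha⟩ : U n)‖, fun x => (hC (⟨a, ha⟩ ⊗ₜ x)).trans_eq ?_⟩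
  change C * ‖(⟨a, ha⟩ : U n) ⊗ₜ[ℂ] x‖ = _
  rw [TensorProduct.norm_tmul, mul_assoc]
  rfl

variable [StarRing A] [CompleteSpace H] [StarModule ℂ A]

theorem isSymmetric_of_inner_eq (ρ : PartialAction A H) (h : ρ.IsDense)
    (hρ : ∀ (a : A) (v x : ρ.domain),
      inner ℂ (ρ.act a v : H) (x : H) = inner ℂ (v : H) (ρ.act (star a) x : H)) :
    ρ.IsSymmetric h := by
  have hle : ρ.domain ≤ ρ.adjointDomain := by
    intro v hv a
    refine ⟨‖(ρ.act (star a) ⟨v, hv⟩ : H)‖, fun x => ?_⟩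
    have := hρ (star a) ⟨v, hv⟩ x
    rw [star_star] at this
    rw [← this]
    exact norm_inner_le_norm _ _
  exact ⟨hle, fun a v => congrArg Subtype.val <|
    ρ.adjointFun_eq h (v := Submodule.inclusion hle v) (w := Submodule.inclusion hle (ρ.act a v))
      fun x => (hρ a v x).symm⟩

theorem inner_adjoint_act (ρ : PartialAction A H) (h : ρ.IsDense) (a : A) (v : ρ.adjointDomain)
    (x : ρ.domain) :
    inner ℂ (((ρ.adjoint h).act a v : ρ.adjointDomain) : H) (x : H)
      = inner ℂ (v : H) (ρ.act (star a) x : H) :=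
  ρ.inner_adjointFun h a v x

end PartialAction

/-! ### From weak to strong differentiability -/

/-- If the scalar functions `⟨x, F⟩`, for `x` in a dense subspace, have the derivative `⟨x, L⟩` near
`y₀` and `L` is continuous at `y₀`, then `F` is differentiable at `y₀` in norm. The mean value
inequality bounds the remainder of `⟨x, F⟩` by `ε ‖y - y₀‖ ‖x‖`, uniformly in `x`. -/
theorem hasFDerivAt_of_inner_of_dense {E H : Type*} [NormedAddCommGroup E] [NormedSpace ℝ E]
    [NormedAddCommGroup H] [InnerProductSpace ℂ H] {W : Set H} (hW : Dense W)
    {F : E → H} {L : E → E →L[ℝ] H} {y₀ : E} (hL : ContinuousAt L y₀)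
    (hF : ∀ᶠ y in nhds y₀, ∀ x ∈ W, HasFDerivAt (fun y => inner ℂ x (F y))
      (((innerSL ℂ x).restrictScalars ℝ) ∘L L y) y) :
    HasFDerivAt F (L y₀) y₀ := by
  rw [hasFDerivAt_iff_isLittleO, Asymptotics.isLittleO_iff]
  intro ε hε
  obtain ⟨r, hr, hball⟩ := Metric.eventually_nhds_iff_ball.1
    (hF.and (Metric.continuousAt_iff'.1 hL ε hε))
  filter_upwards [Metric.ball_mem_nhds y₀ hr] with y hy
  set R : H := F y - F y₀ - L y₀ (y - y₀)
  have key : ∀ x : H, ‖inner ℂ x R‖ ≤ ε * ‖y - y₀‖ * ‖x‖ := by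
    intro x
    refine hW.induction (P := fun x => ‖inner ℂ x R‖ ≤ ε * ‖y - y₀‖ * ‖x‖) (fun x hx => ?_)
      (isClosed_le (by fun_prop) (by fun_prop)) x
    have hd : ∀ z ∈ Metric.ball y₀ r, HasFDerivWithinAt
        (fun z => inner ℂ x (F z) - ((innerSL ℂ x).restrictScalars ℝ ∘L L y₀) z)
        ((innerSL ℂ x).restrictScalars ℝ ∘L L z - (innerSL ℂ x).restrictScalars ℝ ∘L L y₀)
        (Metric.ball y₀ r) z := fun z hz =>
      (((hball z hz).1 x hx).sub
        ((innerSL ℂ x).restrictScalars ℝ ∘L L y₀).hasFDerivAt).hasFDerivWithinAt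
    have hb : ∀ z ∈ Metric.ball y₀ r,
        ‖(innerSL ℂ x).restrictScalars ℝ ∘L L z - (innerSL ℂ x).restrictScalars ℝ ∘L L y₀‖
          ≤ ε * ‖x‖ := by
      intro z hz
      rw [← ContinuousLinearMap.comp_sub]
      refine (ContinuousLinearMap.opNorm_comp_le _ _).trans ?_
      rw [mul_comm]
      refine mul_le_mul ?_ (by simp) (norm_nonneg _) hε.le
      rw [← dist_eq_norm]
      exact (hball z hz).2.le
    have := (convex_ball y₀ r).norm_image_sub_le_of_norm_hasFDerivWithin_le hd hb
      (Metric.mem_ball_self hr) hy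
    calc ‖inner ℂ x R‖ = _ := by
          congr 1
          simp only [R, inner_sub_right, map_sub]
          simp only [ContinuousLinearMap.comp_apply, ContinuousLinearMap.coe_restrictScalars',
            innerSL_apply_apply]
          ring
      _ ≤ _ := this
      _ = _ := by ring
  have h := key R
  rw [inner_self_eq_norm_sq_to_K, norm_pow, RCLike.norm_ofReal, abs_norm, sq] at h
  rcases (norm_nonneg R).eq_or_lt with h0 | h0
  · rw [← h0]; positivity
  · exact le_of_mul_le_mul_right h h0

noncomputable section

namespace UnitaryRep

/-! ### Orbit maps of a unitary representation -/

section Group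

variable {G : Type*} [Group G] {H : Type*} [NormedAddCommGroup H] [InnerProductSpace ℂ H]
  [CompleteSpace H] (π : G →* unitary (H →L[ℂ] H))

theorem map_inv_map (g : G) (v : H) : (π g⁻¹ : H →L[ℂ] H) ((π g : H →L[ℂ] H) v) = v := by
  rw [← mul_apply_eq_comp, ← Submonoid.coe_mul, ← map_mul]
  simp

theorem map_mul_apply (g h : G) (v : H) :
    (π (g * h) : H →L[ℂ] H) v = (π g : H →L[ℂ] H) ((π h : H →L[ℂ] H) v) := by
  rw [map_mul]
  rfl

theorem inner_map_map (g : G) (v w : H) :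
    inner ℂ ((π g : H →L[ℂ] H) v) ((π g : H →L[ℂ] H) w) = inner ℂ v w :=
  ContinuousLinearMap.inner_map_map_of_mem_unitary (π g).2 v w

theorem inner_map_right (g : G) (v w : H) :
    inner ℂ v ((π g : H →L[ℂ] H) w) = inner ℂ ((π g⁻¹ : H →L[ℂ] H) v) w := by
  rw [← inner_map_map π g⁻¹, map_inv_map]

theorem norm_map (g : G) (v : H) : ‖(π g : H →L[ℂ] H) v‖ = ‖v‖ :=
  ContinuousLinearMap.norm_map_of_mem_unitary (π g).2 v

end Group

variable {E : Type*} [NormedAddCommGroup E] [NormedSpace ℝ E]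
  {M₀ : Type*} [TopologicalSpace M₀] {I : ModelWithCorners ℝ E M₀}
  {G : Type*} [TopologicalSpace G] [ChartedSpace M₀ G] [Group G]
  {H : Type*} [NormedAddCommGroup H] [InnerProductSpace ℂ H] [CompleteSpace H]
  (π : G →* unitary (H →L[ℂ] H))

/-- Smoothness of the orbit map at the identity propagates by left translation. -/
theorem mem_smoothVectors_of_contMDiffAt_one [LieGroup I ∞ G] {v : H}
    (h : ContMDiffAt I 𝓘(ℝ, H) ∞ (fun g => (π g : H →L[ℂ] H) v) 1) : v ∈ smoothVectors I π := by
  intro g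
  have h1 : ContMDiffAt I I ∞ (fun k : G => g⁻¹ * k) g := contMDiff_mul_left g
  have h2 : ContMDiffAt I 𝓘(ℝ, H) ∞ (fun k : G => (π (g⁻¹ * k) : H →L[ℂ] H) v) g :=
    ContMDiffAt.comp (g := fun g => (π g : H →L[ℂ] H) v) g (by simpa using h) h1
  have h3 : ContMDiff 𝓘(ℝ, H) 𝓘(ℝ, H) ∞ (π g : H →L[ℂ] H) :=
    ((π g : H →L[ℂ] H).restrictScalars ℝ).contDiff.contMDiff
  refine (h3.contMDiffAt.comp g h2).congr_of_eventuallyEq (.of_forall fun k => ?_)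
  change _ = (π g : H →L[ℂ] H) ((π (g⁻¹ * k) : H →L[ℂ] H) v)
  rw [← map_mul_apply, mul_inv_cancel_left]

theorem map_mem_smoothVectors [LieGroup I ∞ G] (g : G) {v : H} (hv : v ∈ smoothVectors I π) :
    (π g : H →L[ℂ] H) v ∈ smoothVectors I π := by
  have h : ContMDiff I 𝓘(ℝ, H) ∞ fun k => (π (k * g) : H →L[ℂ] H) v :=
    ContMDiff.comp (g := fun g => (π g : H →L[ℂ] H) v) hv contMDiff_mul_right
  simp only [map_mul_apply] at h
  exact h

/-- The derivative `X ↦ dπ(X)v` of the orbit map of `v` at the identity, as a continuous linear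
map on the model space, which is the tangent space at the identity. -/
def orbitFDeriv (I : ModelWithCorners ℝ E M₀) (v : H) : E →L[ℝ] H :=
  mfderiv I 𝓘(ℝ, H) (fun g => (π g : H →L[ℂ] H) v) (1 : G)

theorem hasFDerivAt_orbit [I.Boundaryless] (v : smoothVectors I π) :
    HasFDerivAt (fun y => (π ((extChartAt I 1).symm y) : H →L[ℂ] H) v)
      (orbitFDeriv π I (v : H)) (extChartAt I 1 (1 : G)) := by
  have h : HasFDerivWithinAt _ (orbitFDeriv π I (v : H)) (Set.range I) _ :=
    (mdifferentiableAt_orbit π v 1).hasMFDerivAt.2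
  rw [I.range_eq_univ, hasFDerivWithinAt_univ] at h
  exact h

/-- Lie algebra elements act by skew-symmetric operators: differentiate
`⟨π(g)v, π(g)w⟩ = ⟨v, w⟩`. -/
theorem inner_lieDeriv_left [I.Boundaryless] (X : GroupLieAlgebra I G) (v w : smoothVectors I π) :
    inner ℂ (lieDeriv π X (v : H)) (w : H) = -inner ℂ (v : H) (lieDeriv π X (w : H)) := by
  have h := (hasFDerivAt_orbit π v).inner ℂ (hasFDerivAt_orbit π w)
  simp only [inner_map_map] at h
  have h1 := congrArg (fun L => L X) (h.unique (hasFDerivAt_const _ _))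
  simp only [extChartAt_to_inv, map_one] at h1
  rw [eq_neg_iff_add_eq_zero, add_comm]
  exact h1

variable [FiniteDimensional ℝ E] [LieGroup I ∞ G]

theorem smoothAction_ι_tmul (z : ℂ) (X : GroupLieAlgebra I G) (v : smoothVectors I π) :
    (((smoothAction I π).act (UniversalEnvelopingAlgebra.ι ℂ (z ⊗ₜ[ℝ] X)) v : smoothVectors I π) : H)
      = z • lieDeriv π X (v : H) := by
  have h : z ⊗ₜ[ℝ] X = z • ((1 : ℂ) ⊗ₜ[ℝ] X) := by simp [TensorProduct.smul_tmul']
  rw [h, map_smul, map_smul]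
  exact congrArg (z • ·) (smoothAction_ι π X v)

/-- The action of the enveloping algebra is symmetric: the identity holds for generators by
`inner_lieDeriv_left` and passes to sums and products. -/
theorem inner_smoothAction [I.Boundaryless] (a : ComplexUEA (GroupLieAlgebra I G)) :
    ∀ v w : (smoothAction I π).domain,
      inner ℂ ((smoothAction I π).act a v : H) (w : H)
        = inner ℂ (v : H) ((smoothAction I π).act (star a) w : H) := by
  induction a using UniversalEnvelopingAlgebra.generators_induction with
  | algebraMap r =>
    intro v w
    rw [ComplexUEA.star_algebraMap', AlgHom.commutes, AlgHom.commutes]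
    simp [Module.algebraMap_end_apply, mul_comm]
  | ι x =>
    intro v w
    rw [ComplexUEA.star_ι]
    induction x with
    | zero => simp
    | add s t hs ht =>
      simp only [map_add, LinearMap.add_apply, Submodule.coe_add, inner_add_left, neg_add,
        inner_add_right, hs, ht]
    | tmul z X =>
      have h : ComplexUEA.conjL (GroupLieAlgebra I G) (z ⊗ₜ[ℝ] X) = conj z ⊗ₜ[ℝ] X := by
        simp [ComplexUEA.conjL]
      rw [h, map_neg, LinearMap.neg_apply, Submodule.coe_neg, inner_neg_right]
      refine (congrArg (inner ℂ · (w : H)) (smoothAction_ι_tmul π z X v)).trans ?_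
      refine Eq.trans ?_ (congrArg (-inner ℂ (v : H) ·) (smoothAction_ι_tmul π (conj z) X w)).symm
      rw [inner_smul_left, inner_smul_right, ← mul_neg]
      exact congrArg (conj z * ·) (inner_lieDeriv_left π X v w)
  | mul a b ha hb =>
    intro v w
    rw [star_mul, map_mul, map_mul, Module.End.mul_apply, Module.End.mul_apply, ha, hb]
  | add a b ha hb =>
    intro v w
    simp only [star_add, map_add, LinearMap.add_apply, Submodule.coe_add, inner_add_left,
      inner_add_right, ha, hb]

end UnitaryRep
end

noncomputable section

namespace UnitaryRep

variable {E : Type*} [NormedAddCommGroup E] [NormedSpace ℝ E]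
  {M₀ : Type*} [TopologicalSpace M₀] {I : ModelWithCorners ℝ E M₀}
  {G : Type*} [TopologicalSpace G] [ChartedSpace M₀ G] [Group G]
  {H : Type*} [NormedAddCommGroup H] [InnerProductSpace ℂ H] [CompleteSpace H]
  (π : G →* unitary (H →L[ℂ] H))

/-! ### The domain of the adjoint consists of smooth vectors -/

theorem contDiffOn_zero_orbit (hπ : ∀ v : H, Continuous fun g => (π g : H →L[ℂ] H) v) (v : H) :
    ContDiffOn ℝ 0 (fun y => (π ((extChartAt I (1 : G)).symm y) : H →L[ℂ] H) v)
      (extChartAt I (1 : G)).target :=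
  contDiffOn_zero.2 ((hπ v).comp_continuousOn (continuousOn_extChartAt_symm 1))

section Chart

variable [I.Boundaryless] [LieGroup I ∞ G]

theorem contMDiffAt_extChartAt_one_symm {y : E} (hy : y ∈ (extChartAt I (1 : G)).target) :
    ContMDiffAt 𝓘(ℝ, E) I ∞ (extChartAt I (1 : G)).symm y :=
  (contMDiffOn_extChartAt_symm (1 : G)).contMDiffAt ((isOpen_extChartAt_target 1).mem_nhds hy)

theorem contMDiffAt_symm_inv_mul_symm {y z : E} (hy : y ∈ (extChartAt I (1 : G)).target)
    (hz : z ∈ (extChartAt I (1 : G)).target) :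
    ContMDiffAt 𝓘(ℝ, E × E) I ∞ (fun p : E × E =>
      ((extChartAt I (1 : G)).symm p.1)⁻¹ * (extChartAt I (1 : G)).symm p.2) (y, z) := by
  have h1 : ContMDiffAt 𝓘(ℝ, E × E) I ∞ (fun p : E × E => (extChartAt I (1 : G)).symm p.1) (y, z) :=
    ContMDiffAt.comp (g := (extChartAt I (1 : G)).symm) (y, z) (contMDiffAt_extChartAt_one_symm hy)
      contDiff_fst.contMDiff.contMDiffAt
  have h2 : ContMDiffAt 𝓘(ℝ, E × E) I ∞ (fun p : E × E => (extChartAt I (1 : G)).symm p.2) (y, z) :=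
    ContMDiffAt.comp (g := (extChartAt I (1 : G)).symm) (y, z) (contMDiffAt_extChartAt_one_symm hz)
      contDiff_snd.contMDiff.contMDiffAt
  exact h1.inv.mul h2

/-- The expression of `(g, h) ↦ g⁻¹ h` in the chart at the identity. -/
def chartInvMul (I : ModelWithCorners ℝ E M₀) (G : Type*) [TopologicalSpace G] [ChartedSpace M₀ G]
    [Group G] (y z : E) : E :=
  extChartAt I (1 : G) (((extChartAt I (1 : G)).symm y)⁻¹ * (extChartAt I (1 : G)).symm z)

theorem contDiffAt_chartInvMul {y : E} (hy : y ∈ (extChartAt I (1 : G)).target) :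
    ContDiffAt ℝ ∞ (Function.uncurry (chartInvMul I G)) (y, y) := by
  rw [← contMDiffAt_iff_contDiffAt]
  exact ContMDiffAt.comp (g := extChartAt I (1 : G)) (y, y)
    (by simpa using contMDiffAt_extChartAt) (contMDiffAt_symm_inv_mul_symm hy hy)

/-- The left logarithmic derivative of the chart at the identity: the direction `h` at the point
with coordinates `y` is the left-invariant vector field `leftLogDeriv I G y h` there. -/
def leftLogDeriv (I : ModelWithCorners ℝ E M₀) (G : Type*) [TopologicalSpace G] [ChartedSpace M₀ G]
    [Group G] (y : E) : E →L[ℝ] E :=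
  fderiv ℝ (chartInvMul I G y) y

theorem contDiffOn_leftLogDeriv :
    ContDiffOn ℝ ∞ (leftLogDeriv I G) (extChartAt I (1 : G)).target := fun y hy =>
  (ContDiffAt.fderiv (contDiffAt_chartInvMul hy) contDiffAt_id (by simp)).contDiffWithinAt

theorem hasFDerivAt_chartInvMul {y : E} (hy : y ∈ (extChartAt I (1 : G)).target) :
    HasFDerivAt (chartInvMul I G y) (leftLogDeriv I G y) y := by
  have h : ContDiffAt ℝ ∞ (chartInvMul I G y) y :=
    (contDiffAt_chartInvMul hy).comp y (contDiffAt_const.prodMk contDiffAt_id)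
  exact (h.differentiableAt (by simp)).hasFDerivAt

/-- The derivative of `g ↦ π(g⁻¹)x` at the identity is `X ↦ -dπ(X)x`, tested against smooth
vectors. -/
theorem hasFDerivAt_orbit_inv (hd : Dense (smoothVectors I π : Set H)) (x : smoothVectors I π) :
    HasFDerivAt (fun y => (π ((extChartAt I 1).symm y)⁻¹ : H →L[ℂ] H) x)
      (-orbitFDeriv π I (x : H)) (extChartAt I 1 (1 : G)) := by
  have h1 : ContMDiff I 𝓘(ℝ, H) ∞ fun g : G => (π g⁻¹ : H →L[ℂ] H) x :=
    ContMDiff.comp (g := fun g => (π g : H →L[ℂ] H) x) x.2 (contMDiff_inv I ∞)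
  have h2 : ContDiffAt ℝ ∞ (fun y => (π ((extChartAt I 1).symm y)⁻¹ : H →L[ℂ] H) x)
      (extChartAt I 1 (1 : G)) := by
    rw [← contMDiffAt_iff_contDiffAt]
    exact ContMDiffAt.comp (g := fun g => (π g⁻¹ : H →L[ℂ] H) x) _ h1.contMDiffAt
      (contMDiffAt_extChartAt_one_symm (mem_extChartAt_target (1 : G)))
  have h3 := (h2.differentiableAt (by simp)).hasFDerivAt
  convert h3 using 1
  ext X
  refine hd.eq_of_inner_right ℂ fun w hw => ?_
  have h4 := (hasFDerivAt_const w (extChartAt I 1 (1 : G))).inner ℂ h3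
  have h5 := (hasFDerivAt_orbit π ⟨w, hw⟩).inner ℂ
    (hasFDerivAt_const (x : H) (extChartAt I 1 (1 : G)))
  simp only [inner_map_right, inv_inv] at h4
  have h6 := congrArg (fun L => L X) (h4.unique h5)
  simp only [ContinuousLinearMap.comp_apply, ContinuousLinearMap.prod_apply,
    fderivInnerCLM_apply, zero_apply, inner_zero_left, inner_zero_right,
    add_zero, zero_add] at h6
  rw [h6, neg_apply, inner_neg_right]
  exact (inner_lieDeriv_left π X ⟨w, hw⟩ x).symm

/-- The derivative of `g ↦ π(g⁻¹)x` in the chart, by left translation to the identity. -/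
theorem hasFDerivAt_orbit_inv' (hd : Dense (smoothVectors I π : Set H)) (x : smoothVectors I π)
    {y : E} (hy : y ∈ (extChartAt I (1 : G)).target) :
    HasFDerivAt (fun y => (π ((extChartAt I 1).symm y)⁻¹ : H →L[ℂ] H) x)
      (-orbitFDeriv π I ((π ((extChartAt I 1).symm y)⁻¹ : H →L[ℂ] H) x) ∘L leftLogDeriv I G y)
      y := by
  set k : G := (extChartAt I 1).symm y with hk
  have h0 : chartInvMul I G y y = extChartAt I 1 (1 : G) := by simp [chartInvMul]
  have h1 := hasFDerivAt_orbit_inv π hd ⟨_, map_mem_smoothVectors π k⁻¹ x.2⟩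
  rw [← h0] at h1
  refine (h1.comp y (hasFDerivAt_chartInvMul hy)).congr_of_eventuallyEq ?_
  have hc : ContinuousAt (fun z => k⁻¹ * (extChartAt I (1 : G)).symm z) y := by
    have := topologicalGroup_of_lieGroup I ∞ (G := G)
    exact continuousAt_const.mul (contMDiffAt_extChartAt_one_symm hy).continuousAt
  have hs : ∀ᶠ z in nhds y, k⁻¹ * (extChartAt I (1 : G)).symm z ∈ (extChartAt I (1 : G)).source :=
    hc.eventually_mem (by
      rw [← hk, inv_mul_cancel]
      exact extChartAt_source_mem_nhds 1)
  filter_upwards [hs] with z hz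
  simp only [Function.comp_apply, chartInvMul]
  rw [← hk, (extChartAt I (1 : G)).left_inv hz, ← map_mul_apply]
  congr 3
  simp

end Chart

variable [FiniteDimensional ℝ E] [LieGroup I ∞ G]

/-- The operators `ρ†(X)`, for `X` in the real Lie algebra, applied to a vector `v` of the domain
of the adjoint action, as a linear function of `X`. -/
def adjointDeriv (hd : (smoothAction I π).IsDense) (v : (smoothAction I π).adjointDomain) :
    GroupLieAlgebra I G →ₗ[ℝ] H where
  toFun X := ((((smoothAction I π).adjoint hd).act
    (UniversalEnvelopingAlgebra.ι ℂ ((1 : ℂ) ⊗ₜ[ℝ] X)) v : (smoothAction I π).adjointDomain) : H)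
  map_add' X Y := by
    rw [TensorProduct.tmul_add, map_add, map_add]
    rfl
  map_smul' c X := by
    have : (1 : ℂ) ⊗ₜ[ℝ] (c • X) = (c : ℂ) • ((1 : ℂ) ⊗ₜ[ℝ] X) := by
      rw [TensorProduct.smul_tmul', ← TensorProduct.smul_tmul]
      simp
    rw [this, map_smul, map_smul]
    rfl

theorem adjointDeriv_mem (hd : (smoothAction I π).IsDense) (v : (smoothAction I π).adjointDomain)
    (X : GroupLieAlgebra I G) : adjointDeriv π hd v X ∈ (smoothAction I π).adjointDomain :=
  (((smoothAction I π).adjoint hd).act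
    (UniversalEnvelopingAlgebra.ι ℂ ((1 : ℂ) ⊗ₜ[ℝ] X)) v).2

theorem inner_adjointDeriv (hd : (smoothAction I π).IsDense)
    (v : (smoothAction I π).adjointDomain) (X : GroupLieAlgebra I G)
    (x : (smoothAction I π).domain) :
    inner ℂ (adjointDeriv π hd v X) (x : H) = -inner ℂ (v : H) (lieDeriv π X (x : H)) := by
  refine ((smoothAction I π).inner_adjoint_act hd
    (UniversalEnvelopingAlgebra.ι ℂ ((1 : ℂ) ⊗ₜ[ℝ] X)) v x).trans ?_
  rw [ComplexUEA.star_ι_real, map_neg, LinearMap.neg_apply, Submodule.coe_neg, inner_neg_right]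
  exact congrArg (-inner ℂ (v : H) ·) (smoothAction_ι π X x)

/-- `adjointDeriv` as a continuous linear map on the model space, which is the tangent space at the
identity. -/
def adjointDerivL (hd : (smoothAction I π).IsDense) (v : (smoothAction I π).adjointDomain) :
    E →L[ℝ] H :=
  LinearMap.toContinuousLinearMap (show E →ₗ[ℝ] H from adjointDeriv π hd v)

variable [I.Boundaryless]

/-- The derivative, at the point with coordinates `y`, of the orbit map of a vector in the domain of
the adjoint action. -/
def adjointOrbitFDeriv (hd : (smoothAction I π).IsDense) (v : (smoothAction I π).adjointDomain)
    (y : E) : E →L[ℝ] H :=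
  ((π ((extChartAt I (1 : G)).symm y) : H →L[ℂ] H).restrictScalars ℝ ∘L adjointDerivL π hd v) ∘L
    leftLogDeriv I G y

theorem contDiffOn_adjointOrbitFDeriv (hd : (smoothAction I π).IsDense) {n : ℕ}
    (hn : ∀ v ∈ (smoothAction I π).adjointDomain, ContDiffOn ℝ n
      (fun y => (π ((extChartAt I (1 : G)).symm y) : H →L[ℂ] H) v) (extChartAt I (1 : G)).target)
    (v : (smoothAction I π).adjointDomain) :
    ContDiffOn ℝ n (adjointOrbitFDeriv π hd v) (extChartAt I (1 : G)).target := by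
  refine ContDiffOn.clm_comp (contDiffOn_clm_apply.2 fun X => ?_)
    (contDiffOn_leftLogDeriv.of_le (by exact_mod_cast le_top))
  exact hn _ (adjointDeriv_mem π hd v X)

/-- Paired with a smooth vector `x`, the orbit map of `v` is `g ↦ ⟨v, π(g⁻¹)x⟩`, which is
differentiable with `v` arbitrary; for `v` in the domain of the adjoint action the derivative is the
pairing of `x` with a continuous function, so the orbit map is differentiable in norm. -/
theorem hasFDerivAt_orbit_of_mem_adjointDomain
    (hπ : ∀ v : H, Continuous fun g => (π g : H →L[ℂ] H) v) (hd : (smoothAction I π).IsDense)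
    (v : (smoothAction I π).adjointDomain) {y : E} (hy : y ∈ (extChartAt I (1 : G)).target) :
    HasFDerivAt (fun y => (π ((extChartAt I (1 : G)).symm y) : H →L[ℂ] H) v)
      (adjointOrbitFDeriv π hd v y) y := by
  have hU := (isOpen_extChartAt_target (I := I) (1 : G)).mem_nhds hy
  have hL : ContinuousAt (adjointOrbitFDeriv π hd v) y :=
    (contDiffOn_adjointOrbitFDeriv π hd (n := 0)
      (fun v _ => contDiffOn_zero_orbit π hπ v) v).continuousOn.continuousAt hU
  refine hasFDerivAt_of_inner_of_dense hd hL ?_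
  filter_upwards [hU] with z hz x hx
  have h := (hasFDerivAt_orbit_inv' π hd ⟨x, hx⟩ hz).inner ℂ (hasFDerivAt_const (v : H) z)
  simp only [inner_map_right _ _ x]
  refine HasFDerivAt.congr_fderiv h (ContinuousLinearMap.ext fun X => ?_)
  let k : G := (extChartAt I (1 : G)).symm z
  let Y : GroupLieAlgebra I G := leftLogDeriv I G z X
  have h1 := inner_adjointDeriv π hd v Y ⟨_, map_mem_smoothVectors π k⁻¹ hx⟩
  have h2 := congrArg conj h1
  rw [map_neg, inner_conj_symm, inner_conj_symm] at h2
  calc _ = inner ℂ ((π k⁻¹ : H →L[ℂ] H) x) (0 : H)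
        + inner ℂ (-lieDeriv π Y ((π k⁻¹ : H →L[ℂ] H) x)) (v : H) := rfl
    _ = inner ℂ ((π k⁻¹ : H →L[ℂ] H) x) (adjointDeriv π hd v Y) := by
      rw [inner_zero_right, zero_add, inner_neg_left, h2]
    _ = inner ℂ x ((π k : H →L[ℂ] H) (adjointDeriv π hd v Y)) := (inner_map_right π k x _).symm
    _ = _ := rfl

/-- Every vector in the domain of the adjoint action is smooth. In the chart at the identity, the
derivative of its orbit map is built from orbit maps of vectors in the same domain, so `C^n` for
all of them implies `C^(n+1)`. -/
theorem adjointDomain_le_smoothVectors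
    (hπ : ∀ v : H, Continuous fun g => (π g : H →L[ℂ] H) v) (hd : (smoothAction I π).IsDense) :
    (smoothAction I π).adjointDomain ≤ smoothVectors I π := by
  have hU := isOpen_extChartAt_target (I := I) (1 : G)
  have key : ∀ n : ℕ, ∀ v ∈ (smoothAction I π).adjointDomain, ContDiffOn ℝ n
      (fun y => (π ((extChartAt I (1 : G)).symm y) : H →L[ℂ] H) v)
      (extChartAt I (1 : G)).target := by
    intro n
    induction n with
    | zero => exact fun v _ => contDiffOn_zero_orbit π hπ v
    | succ n ih =>
      intro v hv
      have hder := fun y hy => hasFDerivAt_orbit_of_mem_adjointDomain π hπ hd ⟨v, hv⟩ (y := y) hy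
      push_cast
      rw [contDiffOn_succ_iff_fderiv_of_isOpen hU]
      refine ⟨fun y hy => (hder y hy).differentiableAt.differentiableWithinAt, by simp, ?_⟩
      exact (contDiffOn_adjointOrbitFDeriv π hd ih ⟨v, hv⟩).congr fun y hy => (hder y hy).fderiv
  intro v hv
  refine mem_smoothVectors_of_contMDiffAt_one π ?_
  have h1 : ContDiffAt ℝ ∞ (fun y => (π ((extChartAt I (1 : G)).symm y) : H →L[ℂ] H) v)
      (extChartAt I (1 : G) 1) :=
    (contDiffOn_infty.2 fun n => key n v hv).contDiffAt (hU.mem_nhds (mem_extChartAt_target 1))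
  rw [contMDiffAt_iff]
  refine ⟨(hπ v).continuousAt, ?_⟩
  exact h1.contDiffWithinAt

end UnitaryRep
end

noncomputable section

namespace UnitaryRep

/-! ### Density of the smooth vectors -/

section Garding

open MeasureTheory

section Average

variable {G : Type*} [TopologicalSpace G] [Group G] [MeasurableSpace G] [BorelSpace G]
  (μ : Measure G) [IsFiniteMeasureOnCompacts μ]
  {H : Type*} [NormedAddCommGroup H] [InnerProductSpace ℂ H] [CompleteSpace H]
  (π : G →* unitary (H →L[ℂ] H))

theorem integrable_smul_orbit (hπ : ∀ v : H, Continuous fun g => (π g : H →L[ℂ] H) v) {f : G → ℝ}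
    (hf : Continuous f) (hfc : HasCompactSupport f) (v : H) :
    Integrable (fun h => f h • (π h : H →L[ℂ] H) v) μ :=
  (hf.smul (hπ v)).integrable_of_hasCompactSupport hfc.smul_right

theorem map_integral_smul_orbit [IsTopologicalGroup G] [μ.IsMulLeftInvariant]
    (hπ : ∀ v : H, Continuous fun g => (π g : H →L[ℂ] H) v) {f : G → ℝ}
    (hf : Continuous f) (hfc : HasCompactSupport f) (v : H) (g : G) :
    (π g : H →L[ℂ] H) (∫ h, f h • (π h : H →L[ℂ] H) v ∂μ)
      = ∫ h, f (g⁻¹ * h) • (π h : H →L[ℂ] H) v ∂μ := by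
  rw [← ContinuousLinearMap.integral_comp_comm _ (integrable_smul_orbit μ π hπ hf hfc v),
    ← integral_mul_left_eq_self (fun h => f (g⁻¹ * h) • (π h : H →L[ℂ] H) v) g]
  refine integral_congr_ae (.of_forall fun h => ?_)
  simp only [inv_mul_cancel_left, map_mul_apply]
  exact ((π g : H →L[ℂ] H).restrictScalars ℝ).map_smul _ _

end Average

variable {E : Type*} [NormedAddCommGroup E] [NormedSpace ℝ E]
  {M₀ : Type*} [TopologicalSpace M₀] {I : ModelWithCorners ℝ E M₀}
  {G : Type*} [TopologicalSpace G] [ChartedSpace M₀ G] [Group G]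

open Classical in
/-- The kernel `(g, h) ↦ f (g⁻¹ h)` in the chart at the identity, extended by zero in the second
variable. -/
def chartKernel (I : ModelWithCorners ℝ E M₀) (f : G → ℝ) (y z : E) : ℝ :=
  if z ∈ (extChartAt I (1 : G)).target then
    f (((extChartAt I (1 : G)).symm y)⁻¹ * (extChartAt I (1 : G)).symm z) else 0

theorem chartKernel_eq_zero {f : G → ℝ} {V C : Set G} (hVC : ∀ a ∈ V, ∀ b ∈ V, a * b ∈ C)
    (hfV : Function.support f ⊆ V) {y z : E} (hy : (extChartAt I (1 : G)).symm y ∈ V)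
    (hz : z ∉ extChartAt I (1 : G) '' C) : chartKernel I f y z = 0 := by
  rw [chartKernel]
  split_ifs with hzt
  · by_contra h
    refine hz ⟨_, ?_, (extChartAt I (1 : G)).right_inv hzt⟩
    have := hVC _ hy _ (hfV h)
    rwa [mul_inv_cancel_left] at this
  · rfl

variable [I.Boundaryless] [LieGroup I ∞ G]

theorem contDiffOn_chartKernel {f : G → ℝ} (hf : ContMDiff I 𝓘(ℝ, ℝ) ∞ f) {V C : Set G}
    (hVC : ∀ a ∈ V, ∀ b ∈ V, a * b ∈ C) (hfV : Function.support f ⊆ V) (hC : IsCompact C)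
    (hCs : C ⊆ (extChartAt I (1 : G)).source) :
    ContDiffOn ℝ ∞ (Function.uncurry (chartKernel I f))
      (((extChartAt I (1 : G)).target ∩ (extChartAt I (1 : G)).symm ⁻¹' V) ×ˢ Set.univ) := by
  rintro ⟨y, z⟩ ⟨⟨hyt, hyV⟩, -⟩
  by_cases hz : z ∈ (extChartAt I (1 : G)).target
  · refine ContDiffAt.contDiffWithinAt ?_
    rw [← contMDiffAt_iff_contDiffAt]
    refine (ContMDiffAt.comp (g := f) (y, z) hf.contMDiffAt
      (contMDiffAt_symm_inv_mul_symm hyt hz)).congr_of_eventuallyEq ?_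
    have : ∀ᶠ p : E × E in nhds (y, z), p.2 ∈ (extChartAt I (1 : G)).target :=
      continuousAt_snd.eventually_mem ((isOpen_extChartAt_target 1).mem_nhds hz)
    filter_upwards [this] with p hp
    exact if_pos hp
  · -- near such a point the kernel vanishes, as `z` is outside the compact image of `C`
    have hk : IsCompact (extChartAt I (1 : G) '' C) :=
      hC.image_of_continuousOn ((continuousOn_extChartAt 1).mono hCs)
    have hzk : z ∉ extChartAt I (1 : G) '' C := by
      rintro ⟨c, hc, rfl⟩
      exact hz ((extChartAt I (1 : G)).map_source (hCs hc))
    have h0 : ∀ᶠ p : E × E in nhdsWithin (y, z)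
        (((extChartAt I (1 : G)).target ∩ (extChartAt I (1 : G)).symm ⁻¹' V) ×ˢ Set.univ),
        Function.uncurry (chartKernel I f) p = 0 := by
      have h1 : ∀ᶠ p : E × E in nhds (y, z), p.2 ∈ (extChartAt I (1 : G) '' C)ᶜ :=
        continuousAt_snd.eventually_mem (hk.isClosed.isOpen_compl.mem_nhds hzk)
      filter_upwards [nhdsWithin_le_nhds h1, self_mem_nhdsWithin] with p hp1 hp2
      exact chartKernel_eq_zero hVC hfV hp2.1.2 hp1
    exact contDiffWithinAt_const.congr_of_eventuallyEq h0
      (chartKernel_eq_zero hVC hfV hyV hzk)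

variable [FiniteDimensional ℝ E]
  {H : Type*} [NormedAddCommGroup H] [InnerProductSpace ℂ H] [CompleteSpace H]
  (π : G →* unitary (H →L[ℂ] H))

/-- Averages of an orbit against a smooth function supported near the identity depend smoothly on a
left translation of that function. In the chart at the identity this is a convolution with a smooth
compactly supported kernel, for the image of the measure under the chart. -/
theorem contMDiffAt_integral_smul_orbit [T2Space G] [MeasurableSpace G] [BorelSpace G]
    (μ : Measure G) [IsFiniteMeasureOnCompacts μ]
    (hπ : ∀ v : H, Continuous fun g => (π g : H →L[ℂ] H) v) {f : G → ℝ}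
    (hf : ContMDiff I 𝓘(ℝ, ℝ) ∞ f) {V C : Set G} (hVo : IsOpen V) (hV1 : (1 : G) ∈ V)
    (hVC : ∀ a ∈ V, ∀ b ∈ V, a * b ∈ C) (hfV : Function.support f ⊆ V) (hC : IsCompact C)
    (hCs : C ⊆ (extChartAt I (1 : G)).source) (v : H) :
    ContMDiffAt I 𝓘(ℝ, H) ∞ (fun g => ∫ h, f (g⁻¹ * h) • (π h : H →L[ℂ] H) v ∂μ) 1 := by
  borelize E
  set κ := extChartAt I (1 : G) with hκ
  set s : Set E := κ.target ∩ κ.symm ⁻¹' V with hs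
  have hso : IsOpen s :=
    (continuousOn_extChartAt_symm (1 : G)).isOpen_inter_preimage (isOpen_extChartAt_target 1) hVo
  have hκC : ContinuousOn κ C := (continuousOn_extChartAt 1).mono hCs
  set k : Set E := κ '' C with hk
  have hkc : IsCompact k := hC.image_of_continuousOn hκC
  have hkt : k ⊆ κ.target := by
    rintro _ ⟨c, hc, rfl⟩
    exact κ.map_source (hCs hc)
  let ν : Measure E := (μ.restrict C).map κ
  have hκm : AEMeasurable κ (μ.restrict C) := hκC.aemeasurable hC.measurableSet
  have hfin : IsFiniteMeasure (μ.restrict C) :=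
    ⟨by simpa using hC.measure_lt_top⟩
  -- `k` carries `ν`, so measurability of `w` is only needed on `k`, where `κ.symm` is continuous
  have hνk : ν.restrict k = ν := by
    refine Measure.restrict_eq_self_of_ae_mem ?_
    refine (ae_map_iff hκm hkc.measurableSet).2 ?_
    filter_upwards [ae_restrict_mem hC.measurableSet] with h hh
    exact ⟨h, hh, rfl⟩
  let w : E → H := fun z => (π (κ.symm z) : H →L[ℂ] H) v
  have hwm : AEStronglyMeasurable w ν := by
    rw [← hνk]
    exact ((hπ v).comp_continuousOn ((continuousOn_extChartAt_symm 1).mono hkt)).aestronglyMeasurable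
      hkc.measurableSet
  have hw : LocallyIntegrable w ν :=
    (Integrable.of_bound hwm ‖v‖ (.of_forall fun z => (norm_map π _ v).le)).locallyIntegrable
  have hΦ := contDiffOn_chartKernel hf hVC hfV hC hCs
  let L : H →L[ℝ] ℝ →L[ℝ] H := (ContinuousLinearMap.lsmul ℝ ℝ).flip
  -- a parameter integral against `ν` is a convolution with the reflected kernel, at the point `0`
  have hconv : ContDiffOn ℝ ∞ (fun q : E × E =>
      (convolution w (fun u => chartKernel I f q.1 (-u)) L ν) q.2) (s ×ˢ Set.univ) := by
    refine contDiffOn_convolution_right_with_param (n := ⊤) L (g := fun y u => chartKernel I f y (-u))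
      hso hkc.neg (fun y u hy hu => ?_) hw ?_
    · exact chartKernel_eq_zero hVC hfV hy.2 fun h => hu h
    · exact hΦ.comp (t := s ×ˢ Set.univ)
        (contDiff_fst.prodMk contDiff_snd.neg).contDiffOn fun p hp => ⟨hp.1, trivial⟩
  have hF : ContDiffOn ℝ ∞ (fun y => ∫ h, f ((κ.symm y)⁻¹ * h) • (π h : H →L[ℂ] H) v ∂μ) s := by
    refine (hconv.comp (contDiff_prodMk_left (0 : E)).contDiffOn
      fun y hy => ⟨hy, trivial⟩).congr fun y hy => ?_
    have hcont : Continuous (chartKernel I f y) := by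
      rw [← continuousOn_univ]
      exact hΦ.continuousOn.comp (by fun_prop : Continuous fun z : E => (y, z)).continuousOn
        fun z hz => ⟨hy, trivial⟩
    calc ∫ h, f ((κ.symm y)⁻¹ * h) • (π h : H →L[ℂ] H) v ∂μ
        = ∫ h in C, f ((κ.symm y)⁻¹ * h) • (π h : H →L[ℂ] H) v ∂μ := by
          refine (setIntegral_eq_integral_of_forall_compl_eq_zero fun h hh => ?_).symm
          rw [smul_eq_zero]
          left
          by_contra h0
          refine hh ?_
          have := hVC _ hy.2 _ (hfV h0)
          rwa [mul_inv_cancel_left] at this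
      _ = ∫ h in C, chartKernel I f y (κ h) • w (κ h) ∂μ := by
          refine setIntegral_congr_fun hC.measurableSet fun h hh => ?_
          simp only [chartKernel, w]
          rw [if_pos (κ.map_source (hCs hh)), κ.left_inv (hCs hh)]
      _ = ∫ z, chartKernel I f y z • w z ∂ν :=
          (integral_map hκm (hcont.aestronglyMeasurable.smul hwm)).symm
      _ = _ := by
          simp [convolution, L]
  have h1s : κ 1 ∈ s := ⟨mem_extChartAt_target 1, by simpa [hκ] using hV1⟩
  have hcomp := ContMDiffAt.comp (1 : G) (hF.contDiffAt (hso.mem_nhds h1s)).contMDiffAt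
    (contMDiffAt_extChartAt (I := I) (n := ∞) (x := (1 : G)))
  refine hcomp.congr_of_eventuallyEq ?_
  filter_upwards [extChartAt_source_mem_nhds (I := I) (1 : G)] with g hg
  simp only [Function.comp_apply]
  rw [κ.left_inv hg]

/-- Averaging the orbit of `v`, for Haar measure, against bump functions supported near the identity
gives smooth vectors close to `v`. -/
theorem dense_smoothVectors (hπ : ∀ v : H, Continuous fun g => (π g : H →L[ℂ] H) v) :
    Dense (smoothVectors I π : Set H) := by
  have : IsTopologicalGroup G := topologicalGroup_of_lieGroup I ∞
  have : T1Space G := I.t1Space G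
  have : LocallyCompactSpace G := Manifold.locallyCompact_of_finiteDimensional I
  borelize G
  let μ : Measure G := Measure.haar
  refine Metric.dense_iff.2 fun v ε hε => ?_
  obtain ⟨C, hC1, hCs, hC⟩ := local_compact_nhds (extChartAt_source_mem_nhds (I := I) (1 : G))
  obtain ⟨V, hVo, hV1, hVC⟩ := exists_open_nhds_one_split hC1
  have hO : {h : G | dist ((π h : H →L[ℂ] H) v) v < ε / 2} ∈ nhds 1 := by
    have h1 : ContinuousAt (fun h : G => dist ((π h : H →L[ℂ] H) v) v) 1 :=
      ((hπ v).dist continuous_const).continuousAt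
    exact h1.eventually_lt continuousAt_const (by simpa using half_pos hε)
  obtain ⟨f, hf⟩ : ∃ f : SmoothBumpFunction I (1 : G), tsupport f ⊆
      V ∩ {h : G | dist ((π h : H →L[ℂ] H) v) v < ε / 2} := by
    obtain ⟨f, hf, -⟩ := (SmoothBumpFunction.nhds_basis_support (I := I)
      (Filter.inter_mem (hVo.mem_nhds hV1) hO)).mem_iff.1 Filter.univ_mem
    exact ⟨f, hf⟩
  have hfs := (subset_tsupport f).trans hf
  have hfi : Integrable f μ := f.continuous.integrable_of_hasCompactSupport f.hasCompactSupport
  set c : ℝ := ∫ h, f h ∂μ with hc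
  have hc0 : 0 < c := f.continuous.integral_pos_of_hasCompactSupport_nonneg_nonzero
    f.hasCompactSupport (fun h => f.nonneg) (x := 1) (by simp)
  set u : H := ∫ h, f h • (π h : H →L[ℂ] H) v ∂μ with hu
  have hsmooth : u ∈ smoothVectors I π := by
    refine mem_smoothVectors_of_contMDiffAt_one π ?_
    simp only [hu, map_integral_smul_orbit μ π hπ f.continuous f.hasCompactSupport]
    exact contMDiffAt_integral_smul_orbit π μ hπ f.contMDiff hVo hV1 hVC
      (hfs.trans Set.inter_subset_left) hC hCs v
  have hdist : ‖u - c • v‖ ≤ c * (ε / 2) := by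
    have h1 : u - c • v = ∫ h, f h • ((π h : H →L[ℂ] H) v - v) ∂μ := by
      simp only [smul_sub]
      rw [integral_sub (integrable_smul_orbit μ π hπ f.continuous f.hasCompactSupport v)
        (hfi.smul_const v), integral_smul_const]
    rw [h1, hc, ← integral_mul_const]
    refine norm_integral_le_of_norm_le (hfi.mul_const _) (.of_forall fun h => ?_)
    rw [norm_smul, Real.norm_of_nonneg f.nonneg]
    by_cases hh : f h = 0
    · simp [hh]
    · refine mul_le_mul_of_nonneg_left ?_ f.nonneg
      rw [← dist_eq_norm]
      exact (hfs hh).2.le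
  refine ⟨c⁻¹ • u, ?_, Submodule.smul_of_tower_mem _ _ hsmooth⟩
  have h2 : c⁻¹ • u - v = c⁻¹ • (u - c • v) := by
    rw [smul_sub, smul_smul, inv_mul_cancel₀ hc0.ne', one_smul]
  rw [Metric.mem_ball, dist_eq_norm, h2, norm_smul, norm_inv, Real.norm_of_nonneg hc0.le]
  calc c⁻¹ * ‖u - c • v‖ ≤ c⁻¹ * (c * (ε / 2)) := by gcongr
    _ = ε / 2 := by field_simp
    _ < ε := half_lt_self hε

end Garding

end UnitaryRep
end

/-! ### Self-adjointness and the Sobolev spaces -/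

theorem mainTheorem5
    {E : Type*} [NormedAddCommGroup E] [NormedSpace ℝ E] [FiniteDimensional ℝ E]
    {M : Type*} [TopologicalSpace M] (I : ModelWithCorners ℝ E M) [I.Boundaryless]
    {G : Type*} [TopologicalSpace G] [ChartedSpace M G] [Group G] [LieGroup I ∞ G]
    {H : Type*} [NormedAddCommGroup H] [InnerProductSpace ℂ H] [CompleteSpace H]
    (π : G →* unitary (H →L[ℂ] H))
    (hπ : ∀ v : H, Continuous fun g => (π g : H →L[ℂ] H) v) :
    (UnitaryRep.smoothAction I π).IsDense ∧
    (UnitaryRep.smoothAction I π).IsSelfAdjoint ∧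
    (UnitaryRep.smoothAction I π).adjointDomain = UnitaryRep.smoothVectors I π ∧
    ∀ B : ∀ n : ℕ, InnerProductSpace.Core ℂ (ComplexUEA.filtration (GroupLieAlgebra I G) n),
      (⨅ n : ℕ, UnitaryRep.sobolevSpace I π n (B n)) = UnitaryRep.smoothVectors I π := by
  have hd : (UnitaryRep.smoothAction I π).IsDense := UnitaryRep.dense_smoothVectors π hπ
  have hle := UnitaryRep.adjointDomain_le_smoothVectors π hπ hd
  have hsymm := (UnitaryRep.smoothAction I π).isSymmetric_of_inner_eq hd
    (UnitaryRep.inner_smoothAction π)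
  have heq : (UnitaryRep.smoothAction I π).adjointDomain = UnitaryRep.smoothVectors I π :=
    le_antisymm hle hsymm.1
  have hfd : FiniteDimensional ℝ (GroupLieAlgebra I G) :=
    inferInstanceAs (FiniteDimensional ℝ E)
  refine ⟨hd, ⟨hd, hsymm, hsymm.eq_of_domain_le hle⟩, heq, fun B => ?_⟩
  rw [← heq]
  exact (UnitaryRep.smoothAction I π).iInf_boundedPairing_eq _
    (ComplexUEA.exists_mem_filtration _) B
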